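/- Let $N$ be a non-negative integer, let $K$ be a field, and let $X=(x_1,\dots,x_{N-1})$ and $Y=(y_1,\dots,y_{N-2})$ be arbitrary sequences of elements of $K$. The Okada algebra $O_N(X,Y)$ is the unital associative $K$-algebra generated by $E_1,\dots,E_{N-1}$ with the relations \begin{align*} E_i^2 &= x_i E_i && (1\le i\le N-1),\\ E_iE_j &= E_jE_i && (|i-j|\ge 2),\\ E_{i+1}E_iE_{i+1} &= y_i E_{i+1} && (1\le i\le N-2). \end{align*} The Okada monoid $O_N$ is the monoid generated by $E_1,\dots,E_{N-1}$ with the same relations in which all $x_i$ and $y_i$ are equal to $1$. For a permutation $\sigma$ in the symmetric group $S_N$, let $c_i=\#\{j<i : \sigma^{-1}(j)>\sigma^{-1}(i)\}$ for $1\le i\le N$ (the code of $\sigma$), and let $$e_\sigma=\prod_{i=1}^{N} E_{i-1}E_{i-2}\cdots E_{i-c_i},$$ where the factors are multiplied from left to right with $i$ increasing, and the $i$-th factor is $1$ if $c_i=0$; this defines an element $e_\sigma$ both of $O_N$ and of $O_N(X,Y)$. **Theorem.** The map $\sigma\mapsto e_\sigma$ is a bijection from $S_N$ onto the Okada monoid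 $O_N$, and the family $(e_\sigma)_{\sigma\in S_N}$ is a $K$-basis of the Okada algebra $O_N(X,Y)$. In particular $\dim_K O_N(X,Y)=N!$, for every choice of the parameters $X$ and $Y$. -/

import Mathlib

namespace Okada

/-- The defining relations of the Okada algebra `O_N(X, Y)`. The generator `E_i` (`1 ≤ i ≤ N - 1`)
is the letter `i - 1 : Fin (N - 1)`, and the parameters `x_i` and `y_i` are `X (i - 1)` and
`Y (i - 1)`. -/
inductive AlgRel {K : Type*} [Field K] (N : ℕ) (X : Fin (N - 1) → K) (Y : Fin (N - 2) → K) :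
    FreeAlgebra K (Fin (N - 1)) → FreeAlgebra K (Fin (N - 1)) → Prop
  /-- `E_i ^ 2 = x_i E_i` -/
  | sq (i : Fin (N - 1)) :
      AlgRel N X Y (FreeAlgebra.ι K i * FreeAlgebra.ι K i) (X i • FreeAlgebra.ι K i)
  /-- `E_i E_j = E_j E_i` for `|i - j| ≥ 2` -/
  | comm (i j : Fin (N - 1)) (h : (i : ℕ) + 2 ≤ j ∨ (j : ℕ) + 2 ≤ i) :
      AlgRel N X Y (FreeAlgebra.ι K i * FreeAlgebra.ι K j)
        (FreeAlgebra.ι K j * FreeAlgebra.ι K i)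
  /-- `E_{i+1} E_i E_{i+1} = y_i E_{i+1}` for `1 ≤ i ≤ N - 2` -/
  | sandwich (i : Fin (N - 2)) :
      AlgRel N X Y
        (FreeAlgebra.ι K ⟨i + 1, by omega⟩ * FreeAlgebra.ι K ⟨i, by omega⟩ *
          FreeAlgebra.ι K ⟨i + 1, by omega⟩)
        (Y i • FreeAlgebra.ι K ⟨i + 1, by omega⟩)

/-- The Okada algebra `O_N(X, Y)`. -/
abbrev Alg {K : Type*} [Field K] (N : ℕ) (X : Fin (N - 1) → K) (Y : Fin (N - 2) → K) :
    Type _ :=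
  RingQuot (AlgRel N X Y)

/-- The generators of the Okada algebra. -/
noncomputable def Alg.gen {K : Type*} [Field K] {N : ℕ} (X : Fin (N - 1) → K)
    (Y : Fin (N - 2) → K) (i : Fin (N - 1)) : Alg N X Y :=
  RingQuot.mkAlgHom K (AlgRel N X Y) (FreeAlgebra.ι K i)

/-- The defining relations of the Okada monoid: the same, with all parameters equal to `1`. -/
inductive MonRel (N : ℕ) : FreeMonoid (Fin (N - 1)) → FreeMonoid (Fin (N - 1)) → Prop
  | sq (i : Fin (N - 1)) :
      MonRel N (FreeMonoid.of i * FreeMonoid.of i) (FreeMonoid.of i)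
  | comm (i j : Fin (N - 1)) (h : (i : ℕ) + 2 ≤ j ∨ (j : ℕ) + 2 ≤ i) :
      MonRel N (FreeMonoid.of i * FreeMonoid.of j) (FreeMonoid.of j * FreeMonoid.of i)
  | sandwich (i : Fin (N - 2)) :
      MonRel N
        (FreeMonoid.of ⟨i + 1, by omega⟩ * FreeMonoid.of ⟨i, by omega⟩ *
          FreeMonoid.of ⟨i + 1, by omega⟩)
        (FreeMonoid.of ⟨i + 1, by omega⟩)

/-- The Okada monoid. -/
abbrev Mon (N : ℕ) : Type := PresentedMonoid (MonRel N)

/-- The generators of the Okada monoid. -/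
def Mon.gen {N : ℕ} (i : Fin (N - 1)) : Mon N := PresentedMonoid.of (MonRel N) i

/-- The code of a permutation: `c_i` is the number of `j < i` with `σ⁻¹ j > σ⁻¹ i`. -/
def code {N : ℕ} (σ : Equiv.Perm (Fin N)) (i : Fin N) : ℕ :=
  (Finset.univ.filter fun j : Fin N => j < i ∧ σ⁻¹ i < σ⁻¹ j).card

theorem code_le {N : ℕ} (σ : Equiv.Perm (Fin N)) (i : Fin N) : code σ i ≤ i := by
  calc code σ i ≤ (Finset.Iio i).card :=
        Finset.card_le_card fun j hj => by
          simp only [Finset.mem_filter] at hj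
          exact Finset.mem_Iio.2 hj.2.1
    _ = i := Fin.card_Iio i

/-- The descending run of `code σ i` letters `i - 1, i - 2, …, i - code σ i`. Since both `Fin N`
and the letters in `Fin (N - 1)` are counted from `0`, these are the generators
`E_{I-1}, E_{I-2}, …, E_{I-c_I}` for `I = i + 1`. -/
def run {N : ℕ} (σ : Equiv.Perm (Fin N)) (i : Fin N) : List (Fin (N - 1)) :=
  List.ofFn fun k : Fin (code σ i) =>
    ⟨(i : ℕ) - 1 - k, by have h₁ := code_le σ i; have h₂ := k.2; have h₃ := i.2; omega⟩

/-- The word of `σ`: the concatenation of its descending runs, for increasing `i`. -/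
def word {N : ℕ} (σ : Equiv.Perm (Fin N)) : List (Fin (N - 1)) :=
  (List.ofFn fun i : Fin N => run σ i).flatten

/-- The monomial `e_σ` in the Okada monoid. -/
def Mon.e {N : ℕ} (σ : Equiv.Perm (Fin N)) : Mon N :=
  ((word σ).map Mon.gen).prod

/-- The monomial `e_σ` in the Okada algebra. -/
noncomputable def Alg.e {K : Type*} [Field K] {N : ℕ} (X : Fin (N - 1) → K)
    (Y : Fin (N - 2) → K) (σ : Equiv.Perm (Fin N)) : Alg N X Y :=
  ((word σ).map (Alg.gen X Y)).prod

end Okada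

/-!
The proof is by induction on the rank. Let `g 0, …, g (n - 1)` be the generators in rank `n + 1`,
and let `D_k = g (n - 1) * ⋯ * g k` for `k ≤ n`. The relations rewrite `D_k * g i` as `a * D_l` with
`a` in the subalgebra `B` generated by `g 0, …, g (n - 2)`, so `∑ k, B * D_k` is the whole algebra,
and the products of descending runs span it. A permutation is determined by its code, so by counting
these products are exactly the `e_σ`.

Conversely, the rules `D_k * g i ↦ a * D_l` define monomial matrices over any algebra in which the
relations of rank `n` hold, and these matrices satisfy the relations of rank `n + 1`. The last row
of the matrix of a product `b * D_k` of descending runs has the single entry `b`, in column `k`, so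
independence of the `b` gives independence of the `b * D_k`.

Over `ℚ` with all parameters equal to `1`, the Okada monoid maps to the Okada algebra, where the
`e_σ` are distinct, and the Okada algebra maps to the monoid algebra, so the `e_σ` span the latter
and therefore exhaust the monoid.
-/

namespace Okada

section DescendingProducts

variable {M M' : Type*} [Monoid M] [Monoid M'] (g : ℕ → M)

/-- The descending product `g (b - 1) * g (b - 2) * ⋯ * g k`, equal to `1` if `b ≤ k`. -/
def descProd (b k : ℕ) : M :=
  ((List.Ico k b).reverse.map g).prod

theorem descProd_of_le {b k : ℕ} (h : b ≤ k) : descProd g b k = 1 := by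
  simp [descProd, List.Ico.eq_nil_of_le h]

theorem descProd_eq_mul_right {b k : ℕ} (h : k < b) :
    descProd g b k = descProd g b (k + 1) * g k := by
  simp [descProd, List.Ico.eq_cons h]

theorem descProd_succ {b k : ℕ} (h : k ≤ b) : descProd g (b + 1) k = g b * descProd g b k := by
  simp [descProd, List.Ico.succ_top h]

variable {g} in
theorem descProd_mem {S : Submonoid M} {b k : ℕ} (h : ∀ i < b, g i ∈ S) :
    descProd g b k ∈ S := by
  refine S.list_prod_mem fun a ha => ?_
  obtain ⟨i, hi, rfl⟩ := List.mem_map.1 ha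
  exact h i (List.Ico.mem.1 (List.mem_reverse.1 hi)).2

theorem map_descProd (φ : M →* M') (b k : ℕ) : φ (descProd g b k) = descProd (φ ∘ g) b k := by
  rw [descProd, map_list_prod, List.map_map, descProd]

/-- Sequences `c` with `0 ≤ c i ≤ i`. They index the normal forms `codeProd g c`: the `i`-th entry
is the last index of the `i`-th descending run (`i` if the run is empty), not its length `i - c i`,
which is the entry of the usual code of a permutation. -/
abbrev Code (n : ℕ) : Type := ∀ i : Fin n, Fin (i + 1)

/-- A code of length `n + 1` consists of its last entry and of a code of length `n`. -/
def Code.snocEquiv (n : ℕ) : Fin (n + 1) × Code n ≃ Code (n + 1) :=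
  Fin.snocEquiv fun i : Fin (n + 1) => Fin (i + 1)

/-- The normal form with code `c`: the product of the descending runs
`g (i - 1) * g (i - 2) * ⋯ * g (c i)` for increasing `i`. -/
def codeProd {n : ℕ} (c : Code n) : M :=
  (List.ofFn fun i => descProd g i (c i)).prod

theorem codeProd_snoc {n : ℕ} (k : Fin (n + 1)) (c : Code n) :
    codeProd g (Code.snocEquiv n (k, c)) = codeProd g c * descProd g n k := by
  rw [codeProd, List.ofFn_succ', List.concat_eq_append, List.prod_append, List.prod_singleton]
  simp [codeProd, Code.snocEquiv]

variable {g} in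
theorem codeProd_mem {S : Submonoid M} {n : ℕ} (h : ∀ i, i + 1 < n → g i ∈ S) (c : Code n) :
    codeProd g c ∈ S := by
  refine S.list_prod_mem fun a ha => ?_
  obtain ⟨i, rfl⟩ := (List.mem_ofFn' _ _).1 ha
  exact descProd_mem fun j hj => h j (by omega)

theorem map_codeProd (φ : M →* M') {n : ℕ} (c : Code n) :
    φ (codeProd g c) = codeProd (φ ∘ g) c := by
  simp only [codeProd, map_list_prod, List.map_ofFn, Function.comp_def, map_descProd]

end DescendingProducts

section Relations

variable {K A : Type*} [CommSemiring K] [Semiring A] [Algebra K A]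

/-- The elements `g 0, …, g (n - 2)` satisfy the defining relations of the Okada algebra of rank
`n`. Families are indexed by `ℕ`, so that passing from rank `n` to rank `n + 1` needs no casts;
the values of `g` from `n - 1` on are arbitrary. -/
structure IsOkada (n : ℕ) (x y : ℕ → K) (g : ℕ → A) : Prop where
  sq : ∀ i, i + 1 < n → g i * g i = x i • g i
  comm : ∀ i j, i + 2 ≤ j → j + 1 < n → Commute (g i) (g j)
  sandwich : ∀ i, i + 2 < n → g (i + 1) * g i * g (i + 1) = y i • g (i + 1)

variable {n : ℕ} {x y : ℕ → K} {g : ℕ → A} {i j k b : ℕ}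

theorem IsOkada.mono {m : ℕ} (h : IsOkada n x y g) (hm : m ≤ n) : IsOkada m x y g :=
  ⟨fun i hi => h.sq i (by omega), fun i j hij hj => h.comm i j hij (by omega),
    fun i hi => h.sandwich i (by omega)⟩

theorem IsOkada.commute_descProd_of_lt (h : IsOkada n x y g) (hb : b < i) (hi : i + 1 < n) :
    Commute (descProd g b k) (g i) := by
  induction b with
  | zero => simp [descProd_of_le]
  | succ b ih =>
    rcases Nat.lt_or_ge b k with hk | hk
    · simp [descProd_of_le g hk]
    · rw [descProd_succ g hk]
      exact (h.comm b i (by omega) hi).mul_left (ih (by omega))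

theorem IsOkada.commute_descProd_of_add_two_le (h : IsOkada n x y g) (hk : i + 2 ≤ k)
    (hb : b < n) : Commute (descProd g b k) (g i) := by
  induction b with
  | zero => simp [descProd_of_le]
  | succ b ih =>
    rcases Nat.lt_or_ge b k with hk' | hk'
    · simp [descProd_of_le g hk']
    · rw [descProd_succ g hk']
      exact (h.comm i b (by omega) hb).symm.mul_left (ih (by omega))

theorem IsOkada.descProd_mul_of_le (h : IsOkada n x y g) (hk : k ≤ i) (hi : i + 1 < b)
    (hb : b < n) :
    descProd g b k * g (i + 1) = y i • (descProd g i k * descProd g b (i + 1)) := by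
  induction b, hi using Nat.le_induction with
  | base =>
    have hcomm : Commute (descProd g i k) (g (i + 1)) :=
      h.commute_descProd_of_lt i.lt_succ_self hb
    calc descProd g (i + 2) k * g (i + 1)
        = g (i + 1) * g i * (descProd g i k * g (i + 1)) := by
          rw [descProd_succ g (by omega), descProd_succ g hk]; simp only [mul_assoc]
      _ = g (i + 1) * g i * g (i + 1) * descProd g i k := by rw [hcomm.eq, ← mul_assoc]
      _ = y i • (descProd g i k * g (i + 1)) := by
          rw [h.sandwich i hb, smul_mul_assoc, hcomm.eq]
      _ = y i • (descProd g i k * descProd g (i + 2) (i + 1)) := by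
          rw [descProd_succ g le_rfl, descProd_of_le g le_rfl, mul_one]
  | succ b hib ih =>
    have hcomm : Commute (descProd g i k) (g b) := h.commute_descProd_of_lt (by omega) hb
    rw [descProd_succ g (by omega), mul_assoc, ih (by omega), mul_smul_comm, ← mul_assoc,
      ← hcomm.eq, mul_assoc, ← descProd_succ g (by omega)]

end Relations

section Rewriting

variable {K A : Type*} [CommSemiring K] [Semiring A] [Algebra K A]

/-- The end of the descending product obtained when `descProd g n k * g i` is rewritten as
`coeff x y g i k * descProd g n (target i k)`. -/
def target (i k : ℕ) : ℕ := if i + 2 ≤ k then k else i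

/-- The left coefficient obtained when `descProd g n k * g i` is rewritten as
`coeff x y g i k * descProd g n (target i k)`. For `i < n` and `k ≤ n` it only involves
`g 0, …, g (n - 2)`. The subtraction `i - 1` is not truncated, since `k < i` in the last case. -/
def coeff (x y : ℕ → K) (g : ℕ → A) (i k : ℕ) : A :=
  if i + 2 ≤ k then g i
  else if i + 1 = k then 1
  else if i = k then algebraMap K A (x i)
  else y (i - 1) • descProd g (i - 1) k

variable {n : ℕ} {x y : ℕ → K} {g : ℕ → A} {i j k : ℕ}

theorem target_of_add_two_le (h : i + 2 ≤ k) : target i k = k := if_pos h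

theorem target_of_le (h : k ≤ i + 1) : target i k = i := if_neg (by omega)

theorem target_le (hi : i ≤ n) (hk : k ≤ n) : target i k ≤ n := by
  unfold target; split_ifs <;> assumption

theorem target_target (i k : ℕ) : target i (target i k) = target i k := by
  grind [target]

theorem target_comm (h : i + 2 ≤ j) (k : ℕ) : target j (target i k) = target i (target j k) := by
  grind [target]

theorem target_sandwich (i k : ℕ) :
    target (i + 1) (target i (target (i + 1) k)) = target (i + 1) k := by
  grind [target]

theorem coeff_of_add_two_le (h : i + 2 ≤ k) : coeff x y g i k = g i := if_pos h

theorem coeff_add_one : coeff x y g i (i + 1) = 1 := by simp [coeff]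

theorem coeff_self : coeff x y g i i = algebraMap K A (x i) := by simp [coeff]

theorem coeff_of_le (h : k ≤ i) : coeff x y g (i + 1) k = y i • descProd g i k := by
  rw [coeff, if_neg (by omega), if_neg (by omega), if_neg (by omega), Nat.add_sub_cancel]

theorem coeff_cases (i k : ℕ) :
    i + 2 ≤ k ∨ k = i + 1 ∨ k = i ∨ ∃ p, i = p + 1 ∧ k ≤ p := by
  rcases Nat.lt_or_ge k i with h | h
  · exact Or.inr (Or.inr (Or.inr ⟨i - 1, by omega, by omega⟩))
  · omega

theorem coeff_mem {S : Subalgebra K A} (hS : ∀ i, i + 1 < n → g i ∈ S) (hi : i < n)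
    (hk : k ≤ n) : coeff x y g i k ∈ S := by
  rcases coeff_cases i k with hik | rfl | rfl | ⟨p, rfl, hkp⟩
  · rw [coeff_of_add_two_le hik]
    exact hS i (by omega)
  · rw [coeff_add_one]
    exact one_mem S
  · rw [coeff_self]
    exact S.algebraMap_mem _
  · rw [coeff_of_le hkp]
    exact S.smul_mem (descProd_mem (S := S.toSubmonoid) fun j hj => hS j (by omega)) _

theorem IsOkada.descProd_mul (h : IsOkada (n + 1) x y g) (hi : i < n) (hk : k ≤ n) :
    descProd g n k * g i = coeff x y g i k * descProd g n (target i k) := by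
  rcases coeff_cases i k with hik | rfl | rfl | ⟨p, rfl, hkp⟩
  · rw [coeff_of_add_two_le hik, target_of_add_two_le hik,
      (h.commute_descProd_of_add_two_le hik n.lt_succ_self).eq]
  · rw [coeff_add_one, target_of_le le_rfl, one_mul, ← descProd_eq_mul_right g hi]
  · rw [coeff_self, target_of_le k.le_succ, descProd_eq_mul_right g hi, mul_assoc,
      h.sq k (by omega), mul_smul_comm, Algebra.smul_def]
  · rw [coeff_of_le hkp, target_of_le (by omega), h.descProd_mul_of_le hkp hi n.lt_succ_self,
      smul_mul_assoc]

theorem IsOkada.coeff_sq (h : IsOkada n x y g) (hk : k ≤ n) :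
    coeff x y g i k * coeff x y g i (target i k) = x i • coeff x y g i k := by
  rcases Nat.lt_or_ge k (i + 2) with hik | hik
  · rw [target_of_le (by omega), coeff_self, ← Algebra.commutes, Algebra.smul_def]
  · rw [target_of_add_two_le hik, coeff_of_add_two_le hik, h.sq i (by omega)]

theorem IsOkada.coeff_sandwich (h : IsOkada n x y g) (hk : k ≤ n) :
    coeff x y g (i + 1) k * coeff x y g i (target (i + 1) k) *
      coeff x y g (i + 1) (target i (target (i + 1) k)) = y i • coeff x y g (i + 1) k := by
  rcases Nat.lt_or_ge k (i + 3) with hik | hik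
  · rw [target_of_le (i := i + 1) (by omega), target_of_le le_rfl, coeff_add_one,
      coeff_of_le le_rfl, descProd_of_le g le_rfl, mul_one, mul_smul_comm, mul_one]
  · rw [target_of_add_two_le hik, target_of_add_two_le (i := i) (by omega),
      coeff_of_add_two_le hik, coeff_of_add_two_le (by omega), h.sandwich i (by omega)]

theorem IsOkada.coeff_comm (h : IsOkada n x y g) (hij : i + 2 ≤ j) (hj : j < n) (hk : k ≤ n) :
    coeff x y g i k * coeff x y g j (target i k) =
      coeff x y g j k * coeff x y g i (target j k) := by
  rcases coeff_cases j k with hjk | rfl | rfl | ⟨q, rfl, hkq⟩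
  · rw [target_of_add_two_le hjk, target_of_add_two_le (by omega), coeff_of_add_two_le hjk,
      coeff_of_add_two_le (by omega), (h.comm i j hij (by omega)).eq]
  · rw [target_of_le le_rfl, target_of_add_two_le (by omega), coeff_add_one,
      coeff_of_add_two_le (by omega), coeff_of_add_two_le hij, one_mul, mul_one]
  · rw [target_of_le k.le_succ, target_of_add_two_le hij, coeff_self,
      coeff_of_add_two_le hij, Algebra.commutes]
  · have hiq : i < q := by omega
    rw [target_of_le (i := q + 1) (by omega), coeff_of_le hkq, coeff_of_add_two_le hij,
      coeff_of_le (target_le hiq.le hkq), mul_smul_comm, smul_mul_assoc,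
      (h.mono hj.le).descProd_mul hiq hkq]

end Rewriting

section MonomialMatrices

variable {ι K A : Type*} [DecidableEq ι] [CommSemiring K] [Semiring A] [Algebra K A]

/-- The matrix whose `k`-th row has the entry `a k` in column `t k` and zeros elsewhere. -/
def monomialMatrix (a : ι → A) (t : ι → ι) : Matrix ι ι A :=
  Matrix.of fun k => Pi.single (t k) (a k)

theorem row_monomialMatrix (a : ι → A) (t : ι → ι) (k : ι) :
    (monomialMatrix a t).row k = Pi.single (t k) (a k) := rfl

theorem smul_monomialMatrix (c : K) (a : ι → A) (t : ι → ι) :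
    c • monomialMatrix a t = monomialMatrix (c • a) t := by
  ext k l
  exact congrFun (Pi.single_smul (f := fun _ => A) (t k) c (a k)).symm l

variable [Fintype ι]

theorem row_mul_of_row_eq_single {M N : Matrix ι ι A} {j k : ι} {a : A}
    (h : M.row j = Pi.single k a) : (M * N).row j = a • N.row k :=
  calc (M * N).row j = Matrix.vecMul (M.row j) N := Matrix.mul_apply_eq_vecMul M N j
    _ = a • N.row k := by rw [h, Matrix.single_vecMul]

theorem monomialMatrix_mul (a b : ι → A) (s t : ι → ι) :
    monomialMatrix a s * monomialMatrix b t = monomialMatrix (a * b ∘ s) (t ∘ s) := by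
  refine funext fun k => (row_mul_of_row_eq_single (row_monomialMatrix a s k)).trans ?_
  exact (Pi.single_smul (f := fun _ => A) (t (s k)) (a k) (b (s k))).symm

/-- The pairs `(M, a)` such that right multiplication by `M` takes the `j`-th unit row vector `e_j`
to `a e_j`. -/
def rowEigenpairs (A : Type*) [Semiring A] (j : ι) : Submonoid (Matrix ι ι A × A) where
  carrier := {p | p.1.row j = Pi.single j p.2}
  one_mem' := by
    ext l
    simp [Matrix.row_apply, Matrix.one_apply, Pi.single_apply, eq_comm]
  mul_mem' {p q} hp hq := by
    change (p.1 * q.1).row j = Pi.single j (p.2 * q.2)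
    rw [row_mul_of_row_eq_single hp, show q.1.row j = Pi.single j q.2 from hq, ← Pi.single_smul,
      smul_eq_mul]

end MonomialMatrices

section LinearIndependence

variable {K A : Type*} [CommSemiring K] [Semiring A] [Algebra K A]
  {n : ℕ} {x y : ℕ → K} {g : ℕ → A} {i : ℕ}

/-- The matrix of right multiplication by the `i`-th generator of rank `n + 1` on the descending
products `descProd g n 0, …, descProd g n n`, with left coefficients in rank `n`. It is only
meaningful for `i < n`; there `Fin.clamp` does not change the value of `target`. -/
def genMatrix (n : ℕ) (x y : ℕ → K) (g : ℕ → A) (i : ℕ) : Matrix (Fin (n + 1)) (Fin (n + 1)) A :=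
  monomialMatrix (fun k => coeff x y g i k) fun k => Fin.clamp (target i k) n

theorem val_clamp_target {k : ℕ} (hi : i ≤ n) (hk : k ≤ n) :
    (Fin.clamp (target i k) n : ℕ) = target i k := by
  rw [Fin.coe_clamp, min_eq_left (target_le hi hk)]

theorem isOkada_genMatrix (h : IsOkada n x y g) : IsOkada (n + 1) x y (genMatrix n x y g) where
  sq i hi := by
    have hin : i ≤ n := by omega
    rw [genMatrix, monomialMatrix_mul, smul_monomialMatrix]
    congr 1 <;> funext k <;>
      simp only [Function.comp_apply, Pi.mul_apply, Pi.smul_apply, val_clamp_target, hin, k.is_le]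
    · exact h.coeff_sq k.is_le
    · rw [target_target]
  comm i j hij hj := by
    have hin : i ≤ n := by omega
    have hjn : j ≤ n := by omega
    rw [commute_iff_eq, genMatrix, genMatrix, monomialMatrix_mul, monomialMatrix_mul]
    congr 1 <;> funext k <;>
      simp only [Function.comp_apply, Pi.mul_apply, val_clamp_target, hin, hjn, k.is_le]
    · exact h.coeff_comm hij (by omega) k.is_le
    · rw [target_comm hij]
  sandwich i hi := by
    have hin : i ≤ n := by omega
    have hin' : i + 1 ≤ n := by omega
    rw [genMatrix, genMatrix, monomialMatrix_mul, monomialMatrix_mul, smul_monomialMatrix]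
    congr 1 <;> funext k <;>
      simp only [Function.comp_apply, Pi.mul_apply, Pi.smul_apply, val_clamp_target, target_le,
        hin, hin', k.is_le]
    · exact h.coeff_sandwich k.is_le
    · rw [target_sandwich]

theorem genMatrix_mem_rowEigenpairs_last (x y : ℕ → K) (g : ℕ → A) (hi : i + 1 < n) :
    (genMatrix n x y g i, g i) ∈ rowEigenpairs A (Fin.last n) := by
  change (genMatrix n x y g i).row (Fin.last n) = Pi.single (Fin.last n) (g i)
  rw [genMatrix, row_monomialMatrix, Fin.val_last, target_of_add_two_le (by omega),
    coeff_of_add_two_le (by omega)]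
  congr
  simp [Fin.ext_iff]

theorem row_codeProd_genMatrix_last (x y : ℕ → K) (g : ℕ → A) (c : Code n) :
    (codeProd (genMatrix n x y g) c).row (Fin.last n) =
      Pi.single (Fin.last n) (codeProd g c) := by
  have hmem : codeProd (fun i => (genMatrix n x y g i, g i)) c ∈ rowEigenpairs A (Fin.last n) :=
    codeProd_mem (fun i hi => genMatrix_mem_rowEigenpairs_last x y g hi) c
  have hfst := map_codeProd (fun i => (genMatrix n x y g i, g i)) (MonoidHom.fst _ _) c
  have hsnd := map_codeProd (fun i => (genMatrix n x y g i, g i)) (MonoidHom.snd _ _) c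
  exact hfst ▸ hsnd ▸ hmem

theorem row_descProd_genMatrix_last (x y : ℕ → K) (g : ℕ → A) (k : Fin (n + 1)) :
    (descProd (genMatrix n x y g) n k).row (Fin.last n) = Pi.single k 1 := by
  induction k using Fin.reverseInduction with
  | last =>
    rw [Fin.val_last, descProd_of_le _ le_rfl]
    exact one_mem (rowEigenpairs A (Fin.last n))
  | cast k ih =>
    rw [Fin.val_succ] at ih
    rw [Fin.val_castSucc, descProd_eq_mul_right _ k.is_lt, row_mul_of_row_eq_single ih, one_smul,
      genMatrix, row_monomialMatrix, Fin.val_succ, coeff_add_one, target_of_le le_rfl]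
    congr
    simp [Fin.ext_iff, k.is_lt.le]

theorem row_codeProd_snoc_genMatrix_last (x y : ℕ → K) (g : ℕ → A) (k : Fin (n + 1))
    (c : Code n) :
    (codeProd (genMatrix n x y g) (Code.snocEquiv n (k, c))).row (Fin.last n) =
      Pi.single k (codeProd g c) := by
  rw [codeProd_snoc, row_mul_of_row_eq_single (row_codeProd_genMatrix_last x y g c),
    row_descProd_genMatrix_last, ← Pi.single_smul, smul_eq_mul, mul_one]

theorem linearIndependent_codeProd_genMatrix (x y : ℕ → K)
    (h : LinearIndependent K (codeProd g : Code n → A)) :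
    LinearIndependent K (codeProd (genMatrix n x y g) : Code (n + 1) → _) := by
  let lastRow : Matrix (Fin (n + 1)) (Fin (n + 1)) A →ₗ[K] (Fin (n + 1) → A) :=
    LinearMap.proj (Fin.last n)
  let e : (Σ _ : Fin (n + 1), Code n) ≃ Code (n + 1) :=
    (Equiv.sigmaEquivProd _ _).trans (Code.snocEquiv n)
  have hlast : (lastRow ∘ codeProd (genMatrix n x y g)) ∘ e =
      fun p => Pi.single p.1 (codeProd g p.2) :=
    funext fun ⟨k, c⟩ => row_codeProd_snoc_genMatrix_last x y g k c
  refine .of_comp lastRow ((linearIndependent_equiv e).1 ?_)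
  rw [hlast]
  exact Pi.linearIndependent_single (fun _ => codeProd g) fun _ => h

theorem exists_isOkada_linearIndependent.{u} {K : Type u} [CommSemiring K] (x y : ℕ → K) (n : ℕ) :
    ∃ (A : Type u) (_ : Semiring A) (_ : Algebra K A) (g : ℕ → A), IsOkada n x y g ∧
      LinearIndependent K (codeProd g : Code n → A) := by
  induction n with
  | zero =>
    refine ⟨K, inferInstance, inferInstance, 1, ⟨by simp, by simp, by simp⟩, ?_⟩
    have hone : (codeProd 1 : Code 0 → K) = Module.Basis.singleton (Code 0) K := by
      ext c
      simp [codeProd]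
    exact hone ▸ Module.Basis.linearIndependent _
  | succ n ih =>
    obtain ⟨A, _, _, g, hg, hli⟩ := ih
    exact ⟨_, inferInstance, inferInstance, _, isOkada_genMatrix hg,
      linearIndependent_codeProd_genMatrix x y hli⟩

end LinearIndependence

section Spanning

open Submodule

theorem toSubmodule_adjoin_le_of_mul_span_le {K A : Type*} [CommSemiring K] [Semiring A]
    [Algebra K A] {s : Set A} {S : Submodule K A} (hone : 1 ∈ S) (hmul : S * span K s ≤ S) :
    Subalgebra.toSubmodule (Algebra.adjoin K s) ≤ S := by
  rw [Algebra.adjoin_eq_span, span_le]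
  intro a ha
  induction ha using Submonoid.closure_induction_right with
  | one => exact hone
  | mul_right a _ b hb ih => exact hmul (mul_mem_mul ih (subset_span hb))

variable {K A : Type*} [CommSemiring K] [Semiring A] [Algebra K A]
  {n : ℕ} {x y : ℕ → K} {g : ℕ → A}

theorem IsOkada.adjoin_succ_le (h : IsOkada (n + 1) x y g) :
    Subalgebra.toSubmodule (Algebra.adjoin K (g '' {i | i + 1 < n + 1})) ≤
      Subalgebra.toSubmodule (Algebra.adjoin K (g '' {i | i + 1 < n})) *
        span K (Set.range fun k : Fin (n + 1) => descProd g n k) := by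
  set B := Algebra.adjoin K (g '' {i | i + 1 < n})
  set D := span K (Set.range fun k : Fin (n + 1) => descProd g n k)
  have hdesc {k : ℕ} (hk : k ≤ n) : descProd g n k ∈ D :=
    subset_span ⟨⟨k, Nat.lt_succ_of_le hk⟩, rfl⟩
  have hcoeff {i k : ℕ} (hi : i < n) (hk : k ≤ n) : coeff x y g i k ∈ B :=
    coeff_mem (fun j hj => Algebra.subset_adjoin ⟨j, hj, rfl⟩) hi hk
  have hDG : D * span K (g '' {i | i + 1 < n + 1}) ≤ Subalgebra.toSubmodule B * D := by
    rw [span_mul_span, span_le]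
    rintro _ ⟨_, ⟨k, rfl⟩, _, ⟨i, hi, rfl⟩, rfl⟩
    have hi' : i < n := Nat.lt_of_succ_lt_succ hi
    simp only [h.descProd_mul hi' k.is_le]
    exact mul_mem_mul (hcoeff hi' k.is_le) (hdesc (target_le hi'.le k.is_le))
  refine toSubmodule_adjoin_le_of_mul_span_le ?_ ?_
  · rw [← one_mul (1 : A)]
    exact mul_mem_mul (one_mem B) (descProd_of_le g le_rfl ▸ hdesc le_rfl)
  · calc Subalgebra.toSubmodule B * D * span K (g '' {i | i + 1 < n + 1})
        ≤ Subalgebra.toSubmodule B * (Subalgebra.toSubmodule B * D) := by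
          rw [mul_assoc]
          exact mul_le_mul_right hDG _
      _ = Subalgebra.toSubmodule B * D := by
          rw [← mul_assoc, B.isIdempotentElem_toSubmodule.eq]

theorem span_range_codeProd_succ (K : Type*) {A : Type*} [CommSemiring K] [Semiring A]
    [Algebra K A] (n : ℕ) (g : ℕ → A) :
    span K (Set.range (codeProd g : Code (n + 1) → A)) =
      span K (Set.range (codeProd g : Code n → A)) *
        span K (Set.range fun k : Fin (n + 1) => descProd g n k) := by
  let e : Code n × Fin (n + 1) ≃ Code (n + 1) := (Equiv.prodComm _ _).trans (Code.snocEquiv n)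
  rw [span_mul_span, ← Set.image2_mul, Set.image2_range, ← e.surjective.range_comp]
  exact congrArg (fun f => span K (Set.range f)) (funext fun ⟨c, k⟩ => codeProd_snoc g k c)

theorem IsOkada.adjoin_le_span_codeProd (h : IsOkada n x y g) :
    Subalgebra.toSubmodule (Algebra.adjoin K (g '' {i | i + 1 < n})) ≤
      span K (Set.range (codeProd g : Code n → A)) := by
  induction n with
  | zero =>
    have hone : (1 : A) ∈ Set.range (codeProd g : Code 0 → A) := ⟨finZeroElim, by simp [codeProd]⟩
    simpa [Algebra.toSubmodule_bot] using subset_span hone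
  | succ n ih =>
    rw [span_range_codeProd_succ]
    exact h.adjoin_succ_le.trans (mul_le_mul_left (ih (h.mono n.le_succ)) _)

end Spanning

section PermutationCodes

variable {N : ℕ}

theorem code_eq_card_positions (σ : Equiv.Perm (Fin N)) (i : Fin N) :
    code σ i = (Finset.univ.filter fun v => σ v ≤ i ∧ σ⁻¹ i < v).card := by
  refine Finset.card_equiv σ⁻¹ fun j => ?_
  simp only [Finset.mem_filter_univ, Equiv.Perm.inv_def, Equiv.apply_symm_apply]
  refine and_congr_left fun h => ?_
  have hne : j ≠ i := fun hji => h.ne' (congrArg σ.symm hji)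
  exact hne.le_iff_lt.symm

theorem inv_le_inv_of_code_eq {σ τ : Equiv.Perm (Fin N)} {i : Fin N} (hi : code σ i = code τ i)
    (h : ∀ j, i < j → σ⁻¹ j = τ⁻¹ j) : τ⁻¹ i ≤ σ⁻¹ i := by
  have hle (v : Fin N) (hv : τ v ≤ i) : σ v ≤ i := by
    contrapose! hv
    have hτ : v = τ⁻¹ (σ v) := by simpa using h (σ v) hv
    rwa [hτ, Equiv.Perm.inv_def, Equiv.apply_symm_apply]
  by_contra! hlt
  -- The positions counted by `code τ i` would form a proper subset of those counted by `code σ i`.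
  rw [code_eq_card_positions, code_eq_card_positions] at hi
  refine hi.not_gt (Finset.card_lt_card ((Finset.ssubset_iff_of_subset ?_).2 ⟨τ⁻¹ i, ?_, ?_⟩))
  · exact Finset.monotone_filter_right _ fun v _ hv => ⟨hle v hv.1, hlt.trans hv.2⟩
  · exact Finset.mem_filter_univ _ |>.2 ⟨hle _ (τ.apply_symm_apply i).le, hlt⟩
  · simp

theorem code_injective : Function.Injective (code : Equiv.Perm (Fin N) → Fin N → ℕ) := by
  intro σ τ h
  rw [← inv_inj]
  ext1 i
  induction i using WellFoundedGT.induction with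
  | ind i ih =>
    exact le_antisymm (inv_le_inv_of_code_eq (congrFun h i).symm fun j hj => (ih j hj).symm)
      (inv_le_inv_of_code_eq (congrFun h i) ih)

/-- The code of `σ` in the encoding of `Code`: the `i`-th entry is `i - code σ i`, the last index of
the `i`-th run of `word σ` if that run is not empty. -/
def coCode (σ : Equiv.Perm (Fin N)) : Code N := fun i =>
  ⟨i - code σ i, Nat.lt_succ_of_le (Nat.sub_le _ _)⟩

theorem coCode_injective : Function.Injective (coCode (N := N)) := by
  refine fun σ τ h => code_injective (funext fun i => ?_)
  have hi : (i : ℕ) - code σ i = i - code τ i := congrArg Fin.val (congrFun h i)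
  have hσ := code_le σ i
  have hτ := code_le τ i
  omega

theorem coCode_bijective : Function.Bijective (coCode (N := N)) := by
  rw [Fintype.bijective_iff_injective_and_card]
  refine ⟨coCode_injective, ?_⟩
  rw [Fintype.card_perm, Fintype.card_fin, Fintype.card_pi,
    ← Finset.prod_range_add_one_eq_factorial, ← Fin.prod_univ_eq_prod_range]
  simp only [Fintype.card_fin]

theorem run_map_val (σ : Equiv.Perm (Fin N)) (i : Fin N) :
    (run σ i).map Fin.val = (List.Ico (coCode σ i) i).reverse := by
  have hi := code_le σ i
  refine List.ext_getElem ?_ fun k hk _ => ?_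
  · simp [run, coCode, Nat.sub_sub_self hi]
  · simp only [run, coCode, List.Ico, List.map_ofFn, List.length_ofFn, List.getElem_ofFn,
      Function.comp_apply, List.getElem_reverse, List.length_range', List.getElem_range',
      one_mul] at hk ⊢
    omega

theorem word_map_prod {M : Type*} [Monoid M] (g : ℕ → M) (σ : Equiv.Perm (Fin N)) :
    ((word σ).map (g ∘ Fin.val)).prod = codeProd g (coCode σ) := by
  simp only [word, List.map_flatten, List.prod_flatten, List.map_ofFn, codeProd, descProd,
    ← run_map_val, List.map_map, Function.comp_def]

end PermutationCodes

section Algebra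

variable {K : Type*} [Field K] {N : ℕ} (X : Fin (N - 1) → K) (Y : Fin (N - 2) → K)

theorem Alg.gen_sq (i : Fin (N - 1)) : gen X Y i * gen X Y i = X i • gen X Y i := by
  simpa [gen] using RingQuot.mkAlgHom_rel K (AlgRel.sq (X := X) (Y := Y) i)

theorem Alg.gen_comm (i j : Fin (N - 1)) (h : (i : ℕ) + 2 ≤ j ∨ (j : ℕ) + 2 ≤ i) :
    gen X Y i * gen X Y j = gen X Y j * gen X Y i := by
  simpa [gen] using RingQuot.mkAlgHom_rel K (AlgRel.comm (X := X) (Y := Y) i j h)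

theorem Alg.gen_sandwich (i : Fin (N - 2)) :
    gen X Y ⟨i + 1, by omega⟩ * gen X Y ⟨i, by omega⟩ * gen X Y ⟨i + 1, by omega⟩ =
      Y i • gen X Y ⟨i + 1, by omega⟩ := by
  simpa [gen] using RingQuot.mkAlgHom_rel K (AlgRel.sandwich (X := X) (Y := Y) i)

theorem Alg.adjoin_range_gen : Algebra.adjoin K (Set.range (gen X Y)) = ⊤ := by
  have hrange : Set.range (gen X Y) =
      RingQuot.mkAlgHom K (AlgRel N X Y) '' Set.range (FreeAlgebra.ι K) := Set.range_comp _ _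
  rw [hrange, ← AlgHom.map_adjoin, FreeAlgebra.adjoin_range_ι, Algebra.map_top,
    AlgHom.range_eq_top]
  exact RingQuot.mkAlgHom_surjective K _

variable {X Y} {A : Type*} [Semiring A] [Algebra K A]

/-- The universal property of the Okada algebra. -/
noncomputable def Alg.lift (f : Fin (N - 1) → A) (hsq : ∀ i, f i * f i = X i • f i)
    (hcomm : ∀ i j : Fin (N - 1), (i : ℕ) + 2 ≤ j ∨ (j : ℕ) + 2 ≤ i → f i * f j = f j * f i)
    (hsandwich : ∀ i : Fin (N - 2), f ⟨i + 1, by omega⟩ * f ⟨i, by omega⟩ * f ⟨i + 1, by omega⟩ =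
      Y i • f ⟨i + 1, by omega⟩) : Alg N X Y →ₐ[K] A :=
  RingQuot.liftAlgHom K ⟨FreeAlgebra.lift K f, by
    rintro _ _ (i | ⟨i, j, hij⟩ | i)
    · simpa using hsq i
    · simpa using hcomm i j hij
    · simpa using hsandwich i⟩

theorem Alg.lift_gen (f : Fin (N - 1) → A) (hsq hcomm hsandwich) (i : Fin (N - 1)) :
    lift (X := X) (Y := Y) f hsq hcomm hsandwich (gen X Y i) = f i := by
  rw [lift, gen, RingQuot.liftAlgHom_mkAlgHom_apply, FreeAlgebra.lift_ι_apply]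

/-- The universal property of the Okada algebra, for families indexed by `ℕ`. -/
noncomputable def IsOkada.liftAlg {x y : ℕ → K} {g : ℕ → A} (h : IsOkada N x y g) :
    Alg N (x ∘ Fin.val) (y ∘ Fin.val) →ₐ[K] A :=
  Alg.lift (g ∘ Fin.val) (fun i => h.sq i (by omega))
    (fun i j hij => hij.elim (fun hij => h.comm i j hij (by omega))
      fun hji => (h.comm j i hji (by omega)).symm)
    fun i => h.sandwich i (by omega)

theorem Alg.isOkada_gen {x y : ℕ → K} {g : ℕ → Alg N (x ∘ Fin.val) (y ∘ Fin.val)}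
    (hg : g ∘ Fin.val = gen (x ∘ Fin.val) (y ∘ Fin.val)) : IsOkada N x y g := by
  have hgen (i : ℕ) (hi : i < N - 1) : g i = gen _ _ ⟨i, hi⟩ := congrFun hg ⟨i, hi⟩
  refine ⟨fun i hi => ?_, fun i j hij hj => ?_, fun i hi => ?_⟩
  · rw [hgen i (by omega)]
    exact gen_sq _ _ _
  · rw [hgen i (by omega), hgen j (by omega)]
    exact gen_comm _ _ _ _ (.inl hij)
  · rw [hgen i (by omega), hgen (i + 1) (by omega)]
    exact gen_sandwich _ _ ⟨i, by omega⟩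

variable (X Y)

theorem Alg.linearIndependent_e : LinearIndependent K (e X Y) := by
  obtain ⟨x, (rfl : x ∘ Fin.val = X)⟩ := Fin.val_injective.surjective_comp_right X
  obtain ⟨y, (rfl : y ∘ Fin.val = Y)⟩ := Fin.val_injective.surjective_comp_right Y
  obtain ⟨A, _, _, g, hg, hli⟩ := exists_isOkada_linearIndependent x y N
  refine .of_comp hg.liftAlg.toLinearMap ?_
  have hlift : hg.liftAlg ∘ e (x ∘ Fin.val) (y ∘ Fin.val) = codeProd g ∘ coCode := by
    funext σ
    rw [Function.comp_apply, e, map_list_prod, List.map_map, Function.comp_apply,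
      ← word_map_prod]
    congr
    funext i
    exact lift_gen _ _ _ _ i
  exact hlift ▸ hli.comp _ coCode_injective

theorem Alg.span_range_e : Submodule.span K (Set.range (e X Y)) = ⊤ := by
  obtain ⟨x, (rfl : x ∘ Fin.val = X)⟩ := Fin.val_injective.surjective_comp_right X
  obtain ⟨y, (rfl : y ∘ Fin.val = Y)⟩ := Fin.val_injective.surjective_comp_right Y
  obtain ⟨g, hg : g ∘ Fin.val = gen (N := N) (x ∘ Fin.val) (y ∘ Fin.val)⟩ :=
    Fin.val_injective.surjective_comp_right (gen (N := N) (x ∘ Fin.val) (y ∘ Fin.val))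
  have himage : g '' {i | i + 1 < N} = Set.range (gen (x ∘ Fin.val) (y ∘ Fin.val)) := by
    rw [← hg, Set.range_comp, Fin.range_val]
    congr 1
    ext i
    simp [Nat.lt_sub_iff_add_lt]
  have he : e (x ∘ Fin.val) (y ∘ Fin.val) = codeProd g ∘ coCode :=
    funext fun σ => by rw [e, ← hg, word_map_prod, Function.comp_apply]
  have hspan := (isOkada_gen hg).adjoin_le_span_codeProd
  rw [himage, adjoin_range_gen, Algebra.top_toSubmodule, top_le_iff] at hspan
  rw [he, coCode_bijective.surjective.range_comp, hspan]

/-- The basis of the Okada algebra given by the normal forms `e_σ`. -/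
noncomputable def Alg.basis : Module.Basis (Equiv.Perm (Fin N)) K (Alg N X Y) :=
  .mk (linearIndependent_e X Y) (span_range_e X Y).ge

theorem Alg.basis_apply (σ : Equiv.Perm (Fin N)) : basis X Y σ = e X Y σ :=
  Module.Basis.mk_apply _ _ σ

end Algebra

section Monoid

variable {N : ℕ}

theorem Mon.gen_sq (i : Fin (N - 1)) : gen i * gen i = gen i :=
  Quotient.sound (ConGen.Rel.of _ _ (MonRel.sq i))

theorem Mon.gen_comm (i j : Fin (N - 1)) (h : (i : ℕ) + 2 ≤ j ∨ (j : ℕ) + 2 ≤ i) :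
    gen i * gen j = gen j * gen i :=
  Quotient.sound (ConGen.Rel.of _ _ (MonRel.comm i j h))

theorem Mon.gen_sandwich (i : Fin (N - 2)) :
    (gen ⟨i + 1, by omega⟩ * gen ⟨i, by omega⟩ * gen ⟨i + 1, by omega⟩ : Mon N) =
      gen ⟨i + 1, by omega⟩ :=
  Quotient.sound (ConGen.Rel.of _ _ (MonRel.sandwich i))

/-- The homomorphism `E_i ↦ E_i` from the Okada monoid to the rational Okada algebra with all
parameters equal to `1`. -/
noncomputable def Mon.toAlg : Mon N →* Alg (K := ℚ) N 1 1 :=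
  PresentedMonoid.lift (Alg.gen 1 1) (by
    rintro _ _ (i | ⟨i, j, hij⟩ | i)
    · simpa using Alg.gen_sq (K := ℚ) 1 1 i
    · simpa using Alg.gen_comm (K := ℚ) 1 1 i j hij
    · simpa using Alg.gen_sandwich (K := ℚ) 1 1 i)

theorem Mon.toAlg_e (σ : Equiv.Perm (Fin N)) : toAlg (e σ) = Alg.e 1 1 σ := by
  rw [e, map_list_prod, List.map_map]
  rfl

theorem Mon.e_injective : Function.Injective (e (N := N)) := fun σ τ h =>
  (Alg.linearIndependent_e (K := ℚ) 1 1).injective (by rw [← toAlg_e, ← toAlg_e, h])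

/-- The homomorphism `E_i ↦ E_i` from the rational Okada algebra with all parameters equal to `1` to
the monoid algebra of the Okada monoid. -/
noncomputable def Alg.toMonoidAlgebra : Alg (K := ℚ) N 1 1 →ₐ[ℚ] MonoidAlgebra ℚ (Mon N) :=
  lift (fun i => MonoidAlgebra.of ℚ (Mon N) (Mon.gen i))
    (fun i => by rw [← map_mul, Mon.gen_sq, Pi.one_apply, one_smul])
    (fun i j h => by rw [← map_mul, Mon.gen_comm i j h, map_mul])
    fun i => by rw [← map_mul, ← map_mul, Mon.gen_sandwich, Pi.one_apply, one_smul]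

theorem Alg.toMonoidAlgebra_toAlg (m : Mon N) :
    toMonoidAlgebra (Mon.toAlg m) = MonoidAlgebra.of ℚ (Mon N) m := by
  have hcomp : (toMonoidAlgebra (N := N) : _ →* _).comp Mon.toAlg =
      MonoidAlgebra.of ℚ (Mon N) :=
    PresentedMonoid.ext _ fun i => lift_gen _ _ _ _ i
  exact DFunLike.congr_fun hcomp m

theorem Mon.e_surjective : Function.Surjective (e (N := N)) := by
  intro m
  have hm : toAlg m ∈ Submodule.span ℚ (Set.range (Alg.e (K := ℚ) 1 1)) :=
    Alg.span_range_e (K := ℚ) (N := N) 1 1 ▸ Submodule.mem_top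
  have hrange : Alg.toMonoidAlgebra.toLinearMap '' Set.range (Alg.e (K := ℚ) 1 1) =
      MonoidAlgebra.of ℚ (Mon N) '' Set.range e := by
    simp only [← Set.range_comp, Function.comp_def, ← toAlg_e, AlgHom.toLinearMap_apply,
      Alg.toMonoidAlgebra_toAlg]
  have him := Submodule.mem_map_of_mem (f := Alg.toMonoidAlgebra.toLinearMap) hm
  rw [Submodule.map_span, hrange, AlgHom.toLinearMap_apply, Alg.toMonoidAlgebra_toAlg] at him
  exact (MonoidAlgebra.of_mem_span_of_iff (s := Set.range e)).1 him

end Monoid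

end Okada

theorem mainTheorem1 (N : ℕ) {K : Type*} [Field K]
    (X : Fin (N - 1) → K) (Y : Fin (N - 2) → K) :
    Function.Bijective (Okada.Mon.e : Equiv.Perm (Fin N) → Okada.Mon N) ∧
    (∃ b : Module.Basis (Equiv.Perm (Fin N)) K (Okada.Alg N X Y),
      ∀ σ, b σ = Okada.Alg.e X Y σ) ∧
    Module.finrank K (Okada.Alg N X Y) = N.factorial := by
  refine ⟨⟨Okada.Mon.e_injective, Okada.Mon.e_surjective⟩,
    ⟨Okada.Alg.basis X Y, Okada.Alg.basis_apply X Y⟩, ?_⟩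
  rw [Module.finrank_eq_card_basis (Okada.Alg.basis X Y), Fintype.card_perm, Fintype.card_fin]
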